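/- For $n\ge 3$ let $\mathcal T$ be the regular rooted $n$-ary tree, whose vertices are the finite words over $\{1,\dots,n\}$ (a word $u$ being joined to the words $ux$), and let $\mathrm{Aut}(\mathcal T)$ be the group of its automorphisms fixing the root. For $m\ge 0$ let $\mathrm{Stab}(m)\le \mathrm{Aut}(\mathcal T)$ be the subgroup fixing every word of length $m$. Equip $\mathrm{Aut}(\mathcal T)$ with the metric \[ d(g,h)=\inf\bigl\{\,|\mathrm{Aut}(\mathcal T):\mathrm{Stab}(m)|^{-1} \;:\; m\ge 0,\ g^{-1}h\in \mathrm{Stab}(m)\bigr\}, \] which makes it a (profinite) topological group; closures and the Hausdorff dimension $\dim_{\mathrm H}$ are taken with respect to $d$. For $1\le i\le n$ let $\sigma_i$ be the cycle $(1,2,\dots,i-1,i+1,\dots,n)$ and let $a_i\in\mathrm{Aut}(\mathcal T)$ be defined recursively by $a_i=(1,\dots,1,a_i,1,\dots,1)\sigma_i$ with $a_i$ in the $i$-th coordinate; that is, $a_i$ fixes the empty word, maps the word $iw$ to $i\,a_i(w)$, and maps $xw$ to $\sigma_i(x)\,w$ for each letter $x\neq i$. Let $G_n=\langle a_1,\dots,a_n\rangle$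 and let $\overline{G_n}$ be its closure in $\mathrm{Aut}(\mathcal T)$. Then for every real $\varepsilon>0$ there is $n\ge 3$ such that $\overline{G_n}$ is topologically finitely generated (some finite subset of it generates a dense subgroup) and \[ 1-\varepsilon<\dim_{\mathrm H}(\overline{G_n})\le 1 . \] -/

import Mathlib

namespace HanoiTree

/-- The regular rooted `n`-ary tree. Its vertices are the finite words over the alphabet `Fin n`,
its root is the empty word, and two words are joined by an edge when one of them is obtained from
the other by appending one letter (the undirected Cayley graph of the free monoid on `Fin n`). -/
def tree (n : ℕ) : SimpleGraph (List (Fin n)) where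
  Adj u v := (∃ x, v = u ++ [x]) ∨ (∃ x, u = v ++ [x])
  symm := ⟨fun _ _ h => h.symm⟩
  loopless := ⟨fun u h => by rcases h with ⟨x, h⟩ | ⟨x, h⟩ <;> simp at h⟩

/-- The bijections of the vertex set of the tree that fix the root and preserve edge incidences. -/
def treeAutSubgroup (n : ℕ) : Subgroup (Equiv.Perm (List (Fin n))) where
  carrier := {g | g [] = [] ∧ ∀ u v, (tree n).Adj (g u) (g v) ↔ (tree n).Adj u v}
  one_mem' := ⟨rfl, fun _ _ => Iff.rfl⟩
  mul_mem' := by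
    rintro g h ⟨hg, hg'⟩ ⟨hh, hh'⟩
    exact ⟨by simp [hh, hg], fun u v => by simp [hg', hh']⟩
  inv_mem' := by
    rintro g ⟨hg, hg'⟩
    refine ⟨?_, fun u v => ?_⟩
    · rw [Equiv.Perm.inv_eq_iff_eq, hg]
    · rw [← hg' (g⁻¹ u) (g⁻¹ v)]; simp

/-- The group `Aut(T)` of automorphisms of the regular rooted `n`-ary tree. -/
def TreeAut (n : ℕ) : Type := ↥(treeAutSubgroup n)

instance (n : ℕ) : Group (TreeAut n) := inferInstanceAs (Group ↥(treeAutSubgroup n))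

/-- The action of `Aut(T)` on the vertices of the tree. -/
instance (n : ℕ) : MulAction (TreeAut n) (List (Fin n)) :=
  inferInstanceAs (MulAction ↥(treeAutSubgroup n) (List (Fin n)))

theorem TreeAut.ext {n : ℕ} {g h : TreeAut n} (H : ∀ u : List (Fin n), g • u = h • u) : g = h :=
  Subtype.ext (Equiv.ext H)

theorem TreeAut.smul_nil {n : ℕ} (g : TreeAut n) : g • ([] : List (Fin n)) = [] := g.2.1

theorem TreeAut.adj_smul {n : ℕ} (g : TreeAut n) (u v : List (Fin n)) :
    (tree n).Adj (g • u) (g • v) ↔ (tree n).Adj u v := g.2.2 u v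

theorem TreeAut.length_smul_le {n : ℕ} (g : TreeAut n) (u : List (Fin n)) :
    (g • u).length ≤ u.length := by
  induction u using List.reverseRecOn with
  | nil => simp [g.smul_nil]
  | append_singleton u x ih =>
    have h : (tree n).Adj (g • u) (g • (u ++ [x])) := (g.adj_smul _ _).2 (Or.inl ⟨x, rfl⟩)
    rcases h with ⟨y, h⟩ | ⟨y, h⟩
    · rw [h]; simpa using ih
    · have := congrArg List.length h
      simp at this ⊢
      omega

theorem TreeAut.length_smul {n : ℕ} (g : TreeAut n) (u : List (Fin n)) :
    (g • u).length = u.length :=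
  le_antisymm (g.length_smul_le u) (by simpa using g⁻¹.length_smul_le (g • u))

/-- The `m`-th level stabilizer `Stab(m)` of `Aut(T)`: the automorphisms that fix every vertex of
level `m`. -/
def levelStab (n m : ℕ) : Subgroup (TreeAut n) where
  carrier := {g | ∀ u : List (Fin n), u.length = m → g • u = u}
  one_mem' := fun _ _ => one_smul _ _
  mul_mem' := fun {g h} hg hh u hu => by rw [mul_smul, hh u hu, hg u hu]
  inv_mem' := fun {g} hg u hu => by rw [inv_smul_eq_iff, hg u hu]

instance levelStab_normal (n m : ℕ) : (levelStab n m).Normal where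
  conj_mem g hg k u hu := by
    rw [mul_smul, mul_smul, hg _ (by rw [k⁻¹.length_smul, hu]), smul_inv_smul]

theorem levelStab_finiteIndex (n m : ℕ) : (levelStab n m).FiniteIndex := by
  have hfin : Finite {u : List (Fin n) // u.length = m} :=
    inferInstanceAs (Finite (List.Vector (Fin n) m))
  have hst : ∀ u : {u : List (Fin n) // u.length = m},
      (MulAction.stabilizer (TreeAut n) (u : List (Fin n))).FiniteIndex := by
    intro u
    refine ⟨?_⟩
    rw [MulAction.index_stabilizer]
    have hsub : MulAction.orbit (TreeAut n) (u : List (Fin n)) ⊆ {v | v.length = m} := by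
      rintro _ ⟨g, rfl⟩
      exact (g.length_smul _).trans u.2
    have : (MulAction.orbit (TreeAut n) (u : List (Fin n))).Finite :=
      Set.Finite.subset (Set.finite_coe_iff.1 hfin) hsub
    rw [Ne, Set.ncard_eq_zero this]
    exact (MulAction.nonempty_orbit _).ne_empty
  have heq : levelStab n m = ⨅ u : {u : List (Fin n) // u.length = m},
      MulAction.stabilizer (TreeAut n) (u : List (Fin n)) := by
    ext g
    simp only [Subgroup.mem_iInf, MulAction.mem_stabilizer_iff, Subtype.forall]
    rfl
  rw [heq]
  exact Subgroup.finiteIndex_iInf hst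

theorem levelStab_antitone (n : ℕ) : Antitone (levelStab n) := by
  refine antitone_nat_of_succ_le fun m g hg u hu => ?_
  rcases isEmpty_or_nonempty (Fin n) with hn | ⟨⟨x⟩⟩
  · exact Subsingleton.elim _ _
  · have h1 : g • (u ++ [x]) = u ++ [x] := hg _ (by simp [hu])
    have h : (tree n).Adj (g • u) (g • (u ++ [x])) := (g.adj_smul _ _).2 (Or.inl ⟨x, rfl⟩)
    rw [h1] at h
    rcases h with ⟨y, h⟩ | ⟨y, h⟩
    · exact (List.append_inj_left' h rfl).symm
    · have := congrArg List.length h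
      simp [g.length_smul] at this

/-- The standard metric on `Aut(T)` given by its filtration by level stabilizers:
`d(g, h) = inf {1 / |Aut(T) : Stab(m)| : g⁻¹ h ∈ Stab(m)}` for `g ≠ h`, and `d(g, g) = 0`.
(For `n ≥ 2` the indices are unbounded, so that the infimum is also `0` when `g = h`.) -/
noncomputable def treeDist {n : ℕ} (g h : TreeAut n) : ENNReal :=
  open Classical in
  if g = h then 0 else ⨅ (m : ℕ) (_ : g⁻¹ * h ∈ levelStab n m), ((levelStab n m).index : ENNReal)⁻¹

theorem treeDist_congr {n : ℕ} {g h g' h' : TreeAut n} (h0 : g = h ↔ g' = h')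
    (H : ∀ m, g⁻¹ * h ∈ levelStab n m ↔ g'⁻¹ * h' ∈ levelStab n m) :
    treeDist g h = treeDist g' h' := by
  by_cases hgh : g = h
  · simp [treeDist, hgh, h0.1 hgh]
  · have hgh' : ¬ g' = h' := fun h => hgh (h0.2 h)
    simp only [treeDist, hgh, hgh', H, if_false]

theorem treeDist_comm {n : ℕ} (g h : TreeAut n) : treeDist g h = treeDist h g :=
  treeDist_congr eq_comm fun m => by
    rw [← inv_mem_iff, mul_inv_rev, inv_inv]

theorem treeDist_le_max {n : ℕ} (g h k : TreeAut n) :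
    treeDist g k ≤ max (treeDist g h) (treeDist h k) := by
  by_cases hgh : g = h
  · subst hgh; exact le_max_right _ _
  by_cases hhk : h = k
  · subst hhk; exact le_max_left _ _
  by_cases hgk : g = k
  · simp [treeDist, hgk]
  refine le_of_not_gt fun hlt => ?_
  obtain ⟨h1, h2⟩ := max_lt_iff.1 hlt
  simp only [treeDist, hgh, hhk, if_false, iInf_lt_iff] at h1 h2
  obtain ⟨a, ha, h1⟩ := h1
  obtain ⟨b, hb, h2⟩ := h2
  have key : ∀ c, c ≤ a → c ≤ b →
      treeDist g k ≤ ((levelStab n c).index : ENNReal)⁻¹ := fun c hca hcb => by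
    simp only [treeDist, hgk, if_false]
    refine iInf₂_le c ?_
    have := mul_mem (levelStab_antitone n hca ha) (levelStab_antitone n hcb hb)
    simpa [mul_assoc] using this
  rcases le_total a b with hab | hab
  · exact absurd (key a le_rfl hab) (not_le.2 h1)
  · exact absurd (key b hab le_rfl) (not_le.2 h2)

theorem eq_of_treeDist_eq_zero {n : ℕ} {g h : TreeAut n} (H : treeDist g h = 0) : g = h := by
  by_contra hne
  obtain ⟨u, hu⟩ : ∃ u : List (Fin n), g • u ≠ h • u := by
    by_contra! hall
    exact hne (TreeAut.ext hall)
  have hpos : ((levelStab n u.length).index : ENNReal)⁻¹ ≤ treeDist g h := by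
    simp only [treeDist, hne, if_false]
    refine le_iInf₂ fun m hm => ENNReal.inv_le_inv.2 ?_
    have hmu : m ≤ u.length := by
      by_contra! hlt
      have := levelStab_antitone n hlt.le hm u rfl
      rw [mul_smul, inv_smul_eq_iff] at this
      exact hu this.symm
    have := levelStab_finiteIndex n u.length
    exact_mod_cast Subgroup.index_antitone (levelStab_antitone n hmu)
  rw [H, nonpos_iff_eq_zero, ENNReal.inv_eq_zero] at hpos
  exact ENNReal.natCast_ne_top _ hpos

/-- `Aut(T)` with the metric `treeDist`; its topology is the one for which the level stabilizers
form a basis of neighbourhoods of the identity. -/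
noncomputable instance (n : ℕ) : EMetricSpace (TreeAut n) where
  edist := treeDist
  edist_self g := by simp [treeDist]
  edist_comm := treeDist_comm
  edist_triangle g h k := (treeDist_le_max g h k).trans (max_le le_self_add le_add_self)
  eq_of_edist_eq_zero := eq_of_treeDist_eq_zero

instance (n : ℕ) : IsTopologicalGroup (TreeAut n) where
  continuous_mul := by
    refine LipschitzWith.continuous (K := 1 + 1) fun p q => ?_
    have h1 : edist (p.1 * p.2) (q.1 * p.2) = edist p.1 q.1 :=
      treeDist_congr (by simp) fun m => by
        have := (levelStab_normal n m).mem_comm_iff (a := p.2⁻¹) (b := p.1⁻¹ * q.1 * p.2)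
        simpa [mul_assoc] using this
    have h2 : edist (q.1 * p.2) (q.1 * q.2) = edist p.2 q.2 :=
      treeDist_congr (by simp) fun m => by simp [mul_assoc]
    calc edist (p.1 * p.2) (q.1 * q.2)
        ≤ edist (p.1 * p.2) (q.1 * p.2) + edist (q.1 * p.2) (q.1 * q.2) := edist_triangle _ _ _
      _ = edist p.1 q.1 + edist p.2 q.2 := by rw [h1, h2]
      _ ≤ edist p q + edist p q := by
        gcongr
        · exact le_max_left _ _
        · exact le_max_right _ _
      _ = _ := by push_cast; ring
  continuous_inv := by
    refine LipschitzWith.continuous (K := 1) fun g h => le_of_eq ?_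
    rw [ENNReal.coe_one, one_mul]
    refine treeDist_congr inv_inj fun m => ?_
    rw [inv_inv, (levelStab_normal n m).mem_comm_iff, ← inv_mem_iff, mul_inv_rev, inv_inv]

/-- The cycle `σ_i = (1, 2, …, i - 1, i + 1, …, n)`, with the letters numbered from `0`. -/
def sigma {n : ℕ} (i : Fin n) : Equiv.Perm (Fin n) :=
  ((List.finRange n).filter (fun x => x ≠ i)).formPerm

theorem sigma_self {n : ℕ} (i : Fin n) : sigma i i = i :=
  List.formPerm_apply_of_notMem (by simp)

/-- The action on words of the automorphism `(1, …, 1, a, 1, …, 1) τ`, where `a`, in the `i`-th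
coordinate, is again the automorphism being defined. -/
def genFun {n : ℕ} (τ : Equiv.Perm (Fin n)) (i : Fin n) : List (Fin n) → List (Fin n)
  | [] => []
  | x :: w => τ x :: (if x = i then genFun τ i w else w)

theorem genFun_leftInverse {n : ℕ} {τ : Equiv.Perm (Fin n)} {i : Fin n} (h : τ i = i) :
    Function.LeftInverse (genFun τ⁻¹ i) (genFun τ i) := by
  intro u
  induction u with
  | nil => rfl
  | cons x w ih =>
    have hx : τ x = i ↔ x = i := by
      constructor
      · intro h'; exact τ.injective (h'.trans h.symm)
      · rintro rfl; exact h
    by_cases hxi : x = i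
    · subst hxi
      simp [genFun, ih, h, Equiv.symm_apply_eq]
    · simp [genFun, hx, hxi]

theorem genFun_append {n : ℕ} (τ : Equiv.Perm (Fin n)) (i : Fin n) (u : List (Fin n)) (x : Fin n) :
    ∃ y, genFun τ i (u ++ [x]) = genFun τ i u ++ [y] := by
  induction u with
  | nil => exact ⟨τ x, by simp [genFun]⟩
  | cons z w ih =>
    obtain ⟨y, hy⟩ := ih
    by_cases hz : z = i
    · exact ⟨y, by simp [genFun, hz, hy]⟩
    · exact ⟨x, by simp [genFun, hz]⟩

/-- `a_i` as a bijection of the set of words. -/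
def genPerm {n : ℕ} (i : Fin n) : Equiv.Perm (List (Fin n)) where
  toFun := genFun (sigma i) i
  invFun := genFun (sigma i)⁻¹ i
  left_inv := genFun_leftInverse (sigma_self i)
  right_inv := by
    have := genFun_leftInverse (τ := (sigma i)⁻¹) (i := i)
      (by rw [Equiv.Perm.inv_eq_iff_eq, sigma_self])
    rwa [inv_inv] at this

theorem genPerm_mem {n : ℕ} (i : Fin n) : genPerm i ∈ treeAutSubgroup n := by
  have happ : ∀ u x, ∃ y, genPerm i (u ++ [x]) = genPerm i u ++ [y] := genFun_append (sigma i) i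
  have hchild : ∀ u v, (∃ y, genPerm i v = genPerm i u ++ [y]) ↔ ∃ x, v = u ++ [x] := by
    intro u v
    constructor
    · rintro ⟨y, hy⟩
      rcases List.eq_nil_or_concat' v with rfl | ⟨v', z, rfl⟩
      · have : genPerm i [] = [] := rfl
        rw [this] at hy
        simp at hy
      · obtain ⟨z', hz'⟩ := happ v' z
        rw [hz'] at hy
        have := (genPerm i).injective (List.append_inj_left' hy rfl)
        exact ⟨z, by rw [this]⟩
    · rintro ⟨x, rfl⟩
      exact happ u x
  exact ⟨rfl, fun u v => or_congr (hchild u v) (hchild v u)⟩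

/-- The automorphism `a_i = (1, …, 1, a_i, 1, …, 1) σ_i` of the `n`-ary tree. -/
def gen {n : ℕ} (i : Fin n) : TreeAut n := ⟨genPerm i, genPerm_mem i⟩

/-- The group `G_n` generated by `a_1, …, a_n`. -/
def G (n : ℕ) : Subgroup (TreeAut n) := Subgroup.closure (Set.range gen)

/-- A topological group is topologically finitely generated if some finite subset generates a
dense subgroup. -/
def TopologicallyFG (H : Type*) [Group H] [TopologicalSpace H] : Prop :=
  ∃ S : Finset H, Dense (Subgroup.closure (S : Set H) : Set H)

end HanoiTree

namespace HanoiTree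

variable {n : ℕ}

/-! ### Sections of tree automorphisms -/

/-! An automorphism is determined modulo Stab(m+1) by its action on the letters and its n sections
modulo Stab(m). Hence |Aut(T) : Stab(m)| is at most (n!)^(1+n+…+n^(m-1)). If `G n` has a subgroup K
that acts on the letters at least as the alternating group and contains K × … × K placed below the
letters, the same recursion gives at least (n!/2)^(1+n+…+n^(m-1)) elements of K modulo Stab(m).
Comparing exponents, the dimension of the closure is at least log(n!/2)/log(n!), which tends to 1;
the upper bound 1 holds for every subset of Aut(T). Topological finite generation is immediate,
since the closure is generated topologically by the a_i.

The heart is the construction of K for n ≥ 5 (`exists_branching_subgroup`). For suitable letters a,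
b the element t = a_a a_b⁻¹ acts as a 3-cycle on the letters and has trivial sections off its
support, and t³ fixes the letters and has t itself as a section. So t lies in T = `tripleGroup n`,
the elements that occur as a section of some f in `G n` fixing the letters and supported below three
given letters. T is normalized by `G n`. If two such f share only one letter of their supports,
their commutator is supported below that letter, which plants [T, T] below a letter inside `G n`.
The same trick inside N = [T, T] plants [N, N] into itself, so K = [N, N] works. The alternating
group is perfect, so it survives both passages to derived subgroups.

The counts become a dimension through a mass distribution argument for Haar measure on the closure
(`le_dimH_of_family`) and through covering by cosets (`dimH_le_one`). -/

theorem TreeAut.exists_smul_append (g : TreeAut n) (u : List (Fin n)) (x : Fin n) :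
    ∃ y, g • (u ++ [x]) = g • u ++ [y] := by
  have h : (tree n).Adj (g • u) (g • (u ++ [x])) := (g.adj_smul _ _).2 (Or.inl ⟨x, rfl⟩)
  rcases h with h | ⟨y, h⟩
  · exact h
  · have := congrArg List.length h
    simp [g.length_smul] at this
    omega

theorem TreeAut.exists_smul_singleton (g : TreeAut n) (x : Fin n) : ∃ y, g • [x] = [y] := by
  simpa [g.smul_nil] using g.exists_smul_append [] x

/-- The action of a tree automorphism on the letters. -/
noncomputable def rootFun (g : TreeAut n) (x : Fin n) : Fin n :=
  (g.exists_smul_singleton x).choose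

theorem smul_singleton (g : TreeAut n) (x : Fin n) : g • [x] = [rootFun g x] :=
  (g.exists_smul_singleton x).choose_spec

/-- The action of a tree automorphism on the letters, as a homomorphism. -/
noncomputable def root : TreeAut n →* Equiv.Perm (Fin n) :=
  MonoidHom.toHomPerm
    { toFun := rootFun
      map_one' := by
        funext x
        have := smul_singleton (1 : TreeAut n) x
        rw [one_smul] at this
        exact (List.cons.inj this).1.symm
      map_mul' := fun g h => by
        funext x
        have := smul_singleton (g * h) x
        rw [mul_smul, smul_singleton, smul_singleton] at this
        exact (List.cons.inj this).1.symm }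

theorem smul_letter (g : TreeAut n) (x : Fin n) : g • [x] = [root g x] := smul_singleton g x

theorem smul_cons_eq (g : TreeAut n) (x : Fin n) (w : List (Fin n)) :
    g • (x :: w) = root g x :: (g • (x :: w)).tail := by
  induction w using List.reverseRecOn with
  | nil => simp [smul_letter]
  | append_singleton w y ih =>
    obtain ⟨z, hz⟩ := g.exists_smul_append (x :: w) y
    rw [List.cons_append] at hz
    rw [hz, ih]
    simp

theorem adj_cons_iff (x : Fin n) (u v : List (Fin n)) :
    (tree n).Adj (x :: u) (x :: v) ↔ (tree n).Adj u v := by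
  simp [tree]

/-- The section of a tree automorphism at a letter. -/
noncomputable def sec (g : TreeAut n) (x : Fin n) : TreeAut n :=
  ⟨{ toFun := fun w => (g • (x :: w)).tail
     invFun := fun w => (g⁻¹ • (root g x :: w)).tail
     left_inv := fun w => by
      change (g⁻¹ • (root g x :: (g • (x :: w)).tail)).tail = w
      rw [← smul_cons_eq, inv_smul_smul, List.tail_cons]
     right_inv := fun w => by
      change (g • (x :: (g⁻¹ • (root g x :: w)).tail)).tail = w
      have h := smul_cons_eq g⁻¹ (root g x) w
      rw [map_inv, show (root g)⁻¹ (root g x) = x from (root g).symm_apply_apply x] at h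
      rw [← h, smul_inv_smul, List.tail_cons] },
    by
      refine ⟨?_, fun u v => ?_⟩
      · change (g • [x]).tail = []
        simp [smul_letter]
      · change (tree n).Adj (g • (x :: u)).tail (g • (x :: v)).tail ↔ _
        rw [← adj_cons_iff (root g x), ← smul_cons_eq, ← smul_cons_eq, g.adj_smul, adj_cons_iff]⟩

theorem smul_cons (g : TreeAut n) (x : Fin n) (w : List (Fin n)) :
    g • (x :: w) = root g x :: sec g x • w := smul_cons_eq g x w

theorem ext_root_sec {g h : TreeAut n} (hr : root g = root h) (hs : ∀ x, sec g x = sec h x) :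
    g = h := by
  refine TreeAut.ext fun u => ?_
  cases u with
  | nil => rw [g.smul_nil, h.smul_nil]
  | cons x w => rw [smul_cons, smul_cons, hr, hs]

theorem sec_mul (g h : TreeAut n) (x : Fin n) :
    sec (g * h) x = sec g (root h x) * sec h x := by
  refine TreeAut.ext fun w => ?_
  have := mul_smul g h (x :: w)
  rw [smul_cons, smul_cons h, smul_cons g, ← mul_smul] at this
  exact (List.cons.inj this).2

theorem sec_one (x : Fin n) : sec (1 : TreeAut n) x = 1 := by
  have := sec_mul (1 : TreeAut n) 1 x
  simpa using this

theorem sec_inv (g : TreeAut n) (x : Fin n) : sec g⁻¹ x = (sec g ((root g)⁻¹ x))⁻¹ := by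
  have := sec_mul g g⁻¹ x
  rw [mul_inv_cancel, sec_one, map_inv] at this
  exact (inv_eq_of_mul_eq_one_right this.symm).symm

theorem sec_conj (g f : TreeAut n) {x : Fin n} (hf : root f x = x) :
    sec (g * f * g⁻¹) (root g x) = sec g x * sec f x * (sec g x)⁻¹ := by
  rw [sec_mul, sec_mul, sec_inv, map_inv,
    show (root g)⁻¹ (root g x) = x from (root g).symm_apply_apply x, hf]

theorem adj_nil_cons (x : Fin n) (w : List (Fin n)) : (tree n).Adj [] (x :: w) ↔ w = [] := by
  simp [tree]

theorem adj_cons_cons (x y : Fin n) (u v : List (Fin n)) :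
    (tree n).Adj (x :: u) (y :: v) ↔ x = y ∧ (tree n).Adj u v := by
  constructor
  · intro h
    have hxy : x = y := by
      rcases h with ⟨z, h⟩ | ⟨z, h⟩
      · exact (List.cons.inj h).1.symm
      · exact (List.cons.inj h).1
    subst hxy
    exact ⟨rfl, (adj_cons_iff _ _ _).1 h⟩
  · rintro ⟨rfl, h⟩
    exact (adj_cons_iff _ _ _).2 h

/-- The action on words of the automorphism fixing the letters and having prescribed sections. -/
def sectionsFun (p : Fin n → TreeAut n) : List (Fin n) → List (Fin n)
  | [] => []
  | x :: w => x :: p x • w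

theorem sectionsFun_sectionsFun (p q : Fin n → TreeAut n) (w : List (Fin n)) :
    sectionsFun p (sectionsFun q w) = sectionsFun (p * q) w := by
  cases w <;> simp [sectionsFun, mul_smul]

theorem sectionsFun_one (w : List (Fin n)) : sectionsFun 1 w = w := by
  cases w <;> simp [sectionsFun]

/-- The automorphism fixing the letters and having prescribed sections. -/
def ofSections : (Fin n → TreeAut n) →* TreeAut n where
  toFun p :=
    ⟨{ toFun := sectionsFun p
       invFun := sectionsFun p⁻¹
       left_inv := fun w => by rw [sectionsFun_sectionsFun, inv_mul_cancel, sectionsFun_one]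
       right_inv := fun w => by rw [sectionsFun_sectionsFun, mul_inv_cancel, sectionsFun_one] },
      rfl, fun u v => by
        change (tree n).Adj (sectionsFun p u) (sectionsFun p v) ↔ _
        have hnil : ∀ x (w : List (Fin n)), p x • w = [] ↔ w = [] := fun x w => by
          rw [← List.length_eq_zero_iff, TreeAut.length_smul, List.length_eq_zero_iff]
        cases u with
        | nil =>
          cases v with
          | nil => rfl
          | cons y v => simp [sectionsFun, adj_nil_cons, hnil]
        | cons x u =>
          cases v with
          | nil => simp [sectionsFun, SimpleGraph.adj_comm _ _ ([] : List (Fin n)), adj_nil_cons, hnil]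
          | cons y v =>
            simp only [sectionsFun, adj_cons_cons]
            refine and_congr_right ?_
            rintro rfl
            exact (p x).adj_smul u v⟩
  map_one' := TreeAut.ext sectionsFun_one
  map_mul' p q := TreeAut.ext fun w => (sectionsFun_sectionsFun p q w).symm

theorem ofSections_smul_cons (p : Fin n → TreeAut n) (x : Fin n) (w : List (Fin n)) :
    ofSections p • (x :: w) = x :: p x • w := rfl

theorem root_ofSections (p : Fin n → TreeAut n) : root (ofSections p) = 1 := by
  ext1 x
  have := ofSections_smul_cons p x []
  rw [smul_cons] at this
  exact (List.cons.inj this).1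

theorem sec_ofSections (p : Fin n → TreeAut n) (x : Fin n) : sec (ofSections p) x = p x := by
  refine TreeAut.ext fun w => ?_
  have := ofSections_smul_cons p x w
  rw [smul_cons] at this
  exact (List.cons.inj this).2

theorem ofSections_sec {g : TreeAut n} (hg : root g = 1) : ofSections (sec g) = g :=
  ext_root_sec (by rw [root_ofSections, hg]) fun x => sec_ofSections _ _

/-- The automorphism fixing the letters, with a prescribed section at one letter and all other
sections trivial. -/
def iota (x : Fin n) : TreeAut n →* TreeAut n := ofSections.comp (MonoidHom.mulSingle (fun _ => TreeAut n) x)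

theorem iota_apply (x : Fin n) (k : TreeAut n) : iota x k = ofSections (Pi.mulSingle x k) := rfl

theorem root_iota (x : Fin n) (k : TreeAut n) : root (iota x k) = 1 := root_ofSections _

theorem sec_iota (x : Fin n) (k : TreeAut n) (v : Fin n) :
    sec (iota x k) v = (Pi.mulSingle x k : Fin n → TreeAut n) v := sec_ofSections _ _

theorem conj_iota (g : TreeAut n) (x : Fin n) (k : TreeAut n) :
    g * iota x k * g⁻¹ = iota (root g x) (sec g x * k * (sec g x)⁻¹) := by
  refine ext_root_sec (by simp [root_iota]) fun v => ?_
  obtain ⟨v, rfl⟩ := (root g).surjective v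
  rw [sec_conj _ _ (by rw [root_iota]; rfl), sec_iota, sec_iota]
  by_cases hv : v = x
  · subst hv; simp
  · simp [hv]

theorem root_gen (i : Fin n) : root (gen i) = sigma i := by
  ext1 x
  have : gen i • [x] = [sigma i x] := by
    change genFun (sigma i) i [x] = _
    simp [genFun]
  rw [smul_letter] at this
  simpa using this

theorem sec_gen (i x : Fin n) : sec (gen i) x = if x = i then gen i else 1 := by
  refine TreeAut.ext fun w => ?_
  have : gen i • (x :: w) = sigma i x :: (if x = i then gen i • w else w) := rfl
  rw [smul_cons] at this
  rw [(List.cons.inj this).2]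
  split <;> simp

end HanoiTree

namespace HanoiTree

variable {n : ℕ}

/-! ### The action of the group on the letters -/

open Equiv Equiv.Perm

/-- Take a, b, c to be the first three letters: the cycles σ_a = (b c …) and σ_b = (a c …) differ
only in their first entry, so the common tail cancels and a 3-cycle a → b → c → a remains. -/
theorem exists_sigma_mul_inv (hn : 3 ≤ n) : ∃ a b c : Fin n, a ≠ b ∧ a ≠ c ∧ b ≠ c ∧
    sigma a * (sigma b)⁻¹ = swap b c * swap a c := by
  have hlen : (List.finRange n).length = n := List.length_finRange
  have hnd := List.nodup_finRange n
  match hL : List.finRange n with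
  | [] => rw [hL] at hlen; simp at hlen; omega
  | [_] => rw [hL] at hlen; simp at hlen; omega
  | [_, _] => rw [hL] at hlen; simp at hlen; omega
  | a :: b :: c :: l =>
    rw [hL] at hnd
    simp only [List.nodup_cons, List.mem_cons, not_or] at hnd
    obtain ⟨⟨hab, hac, hal⟩, ⟨hbc, hbl⟩, hcl, -⟩ := hnd
    have hfa : l.filter (fun x => x ≠ a) = l :=
      List.filter_eq_self.2 fun x hx => by simpa using fun h : x = a => hal (h ▸ hx)
    have hfb : l.filter (fun x => x ≠ b) = l :=
      List.filter_eq_self.2 fun x hx => by simpa using fun h : x = b => hbl (h ▸ hx)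
    refine ⟨a, b, c, hab, hac, hbc, ?_⟩
    have h1 : sigma a = swap b c * (c :: l).formPerm := by
      rw [← List.formPerm_cons_cons, sigma, hL]
      congr 1
      simp [Ne.symm hab, Ne.symm hac] at hfa ⊢
      simpa using hfa
    have h2 : sigma b = swap a c * (c :: l).formPerm := by
      rw [← List.formPerm_cons_cons, sigma, hL]
      congr 1
      simp [hab, Ne.symm hbc] at hfb ⊢
      simpa using hfb
    rw [h1, h2, mul_inv_rev, swap_inv]
    group

theorem exists_pow_sigma (hn : 3 ≤ n) {i x y : Fin n} (hx : x ≠ i) (hy : y ≠ i) :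
    ∃ k : ℕ, (sigma i ^ k) x = y := by
  set l := (List.finRange n).filter (fun x => x ≠ i) with hl
  have hmem : ∀ z, z ∈ l ↔ z ≠ i := fun z => by simp [hl]
  have hnd : l.Nodup := (List.nodup_finRange n).filter _
  have hcard : 2 ≤ l.length := by
    rw [← List.toFinset_card_of_nodup hnd]
    have : l.toFinset = Finset.univ.erase i := by ext z; simp [hmem]
    rw [this, Finset.card_erase_of_mem (Finset.mem_univ _), Finset.card_univ, Fintype.card_fin]
    omega
  have hcyc : (sigma i).IsCycle := List.isCycle_formPerm hnd hcard
  have hsupp : ∀ z, z ≠ i → sigma i z ≠ z := fun z hz => by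
    have := List.support_formPerm_of_nodup l hnd (by rintro z h; rw [h] at hcard; simp at hcard)
    rw [← mem_support, sigma, ← hl, this]
    simp [hmem, hz]
  exact hcyc.exists_pow_eq (hsupp x hx) (hsupp y hy)

theorem gen_mem (i : Fin n) : gen i ∈ G n := Subgroup.subset_closure ⟨i, rfl⟩

theorem exists_mem_ne {n : ℕ} (hn : 3 ≤ n) (a b : Fin n) : ∃ c : Fin n, c ≠ a ∧ c ≠ b := by
  have : ({a, b} : Finset (Fin n)).card < (Finset.univ : Finset (Fin n)).card := by
    rw [Finset.card_univ, Fintype.card_fin]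
    exact (Finset.card_le_two).trans_lt (by omega)
  obtain ⟨c, -, hc⟩ := Finset.exists_mem_notMem_of_card_lt_card this
  exact ⟨c, by simpa using hc⟩

/-- Powers of `gen a` fix a and are transitive on the other letters; moving one letter at a time
gives 2-transitivity, with a detour through a third letter when d = a. -/
theorem exists_root_pair (hn : 3 ≤ n) {a b c d : Fin n} (hab : a ≠ b) (hcd : c ≠ d) :
    ∃ g ∈ G n, root g a = c ∧ root g b = d := by
  have step : ∀ {a b b' : Fin n}, b ≠ a → b' ≠ a → ∃ g ∈ G n, root g a = a ∧ root g b = b' := by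
    intro a b b' hb hb'
    obtain ⟨k, hk⟩ := exists_pow_sigma hn hb hb'
    refine ⟨gen a ^ k, pow_mem (gen_mem a) k, ?_, ?_⟩
    · rw [map_pow, root_gen, ← Equiv.Perm.smul_def]
      exact (MulAction.mem_stabilizer_iff (G := Equiv.Perm (Fin n))).1
        (pow_mem (MulAction.mem_stabilizer_iff.2 (sigma_self a)) k)
    · rw [map_pow, root_gen, hk]
  have main : ∀ {a b c d : Fin n}, a ≠ b → c ≠ d → d ≠ a →
      ∃ g ∈ G n, root g a = c ∧ root g b = d := by
    intro a b c d hab hcd hda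
    obtain ⟨g, hg, h1, h2⟩ := step hab.symm hda
    obtain ⟨h, hh, h3, h4⟩ := step (a := d) hda.symm hcd
    exact ⟨h * g, mul_mem hh hg, by simp [h1, h4], by simp [h2, h3]⟩
  by_cases hda : d = a
  · obtain ⟨e, hea, hec⟩ := exists_mem_ne hn a c
    obtain ⟨g, hg, h1, h2⟩ := main hab hec.symm hea
    obtain ⟨h, hh, h3, h4⟩ := main hec.symm hcd hcd.symm
    exact ⟨h * g, mul_mem hh hg, by simp [h1, h3], by simp [h2, h4]⟩
  · exact main hab hcd hda

/-- Jordan's theorem: a 2-transitive group is primitive, and a primitive group containing a 3-cycle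
contains the alternating group. -/
theorem alternatingGroup_le_map_root (hn : 5 ≤ n) :
    alternatingGroup (Fin n) ≤ (G n).map root := by
  obtain ⟨a, b, c, hab, hac, hbc, h⟩ := exists_sigma_mul_inv (n := n) (by omega)
  have h3 : (sigma a * (sigma b)⁻¹).IsThreeCycle := by
    rw [h, swap_comm b c, swap_comm a c]
    exact isThreeCycle_swap_mul_swap_same hbc.symm hac.symm hab.symm
  refine alternatingGroup_le_of_isPreprimitive_of_isThreeCycle_mem ?_ h3
    ⟨gen a * (gen b)⁻¹, mul_mem (gen_mem a) (inv_mem (gen_mem b)), by simp [root_gen]⟩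
  refine MulAction.isPreprimitive_of_is_two_pretransitive
    (MulAction.is_two_pretransitive_iff.2 fun hxy hzw => ?_)
  obtain ⟨g, hg, h1, h2⟩ := exists_root_pair (by omega) hxy hzw
  exact ⟨⟨root g, g, hg, rfl⟩, h1, h2⟩

/-- The alternating group is (n-2)-transitive, hence 3-transitive once n ≥ 5. -/
theorem exists_root_triple (hn : 5 ≤ n) {H : Subgroup (TreeAut n)}
    (hH : alternatingGroup (Fin n) ≤ H.map root) {a b c a' b' c' : Fin n}
    (hab : a ≠ b) (hac : a ≠ c) (hbc : b ≠ c) (hab' : a' ≠ b') (hac' : a' ≠ c') (hbc' : b' ≠ c') :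
    ∃ g ∈ H, root g a = a' ∧ root g b = b' ∧ root g c = c' := by
  have := alternatingGroup.isMultiplyPretransitive (Fin n)
  have h3 : MulAction.IsMultiplyPretransitive (alternatingGroup (Fin n)) (Fin n) 3 :=
    MulAction.isMultiplyPretransitive_of_le (n := Nat.card (Fin n) - 2) (by simp; omega)
      (Nat.sub_le _ _)
  have inj : ∀ {a b c : Fin n}, a ≠ b → a ≠ c → b ≠ c → Function.Injective ![a, b, c] := by
    intro a b c hab hac hbc i j hij
    fin_cases i <;> fin_cases j <;> simp_all
  obtain ⟨p, hp⟩ := h3.exists_smul_eq ⟨_, inj hab hac hbc⟩ ⟨_, inj hab' hac' hbc'⟩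
  obtain ⟨g, hg, hgp⟩ := hH p.2
  have hp' : ∀ i, (p : Equiv.Perm (Fin n)) (![a, b, c] i) = ![a', b', c'] i :=
    fun i => DFunLike.congr_fun hp i
  refine ⟨g, hg, ?_, ?_, ?_⟩ <;> rw [hgp]
  · exact hp' 0
  · exact hp' 1
  · exact hp' 2

/-- A subgroup of the symmetric group containing a 3-cycle and normalized by the alternating group
contains the alternating group. -/
theorem alternatingGroup_le_of_isThreeCycle_mem (hn : 5 ≤ n) {N : Subgroup (Equiv.Perm (Fin n))}
    (hN : ∀ g ∈ alternatingGroup (Fin n), ∀ h ∈ N, g * h * g⁻¹ ∈ N) {c : Equiv.Perm (Fin n)}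
    (hc : c.IsThreeCycle) (hcN : c ∈ N) : alternatingGroup (Fin n) ≤ N := by
  rw [← closure_three_cycles_eq_alternating, Subgroup.closure_le]
  intro d hd
  obtain ⟨g, hg⟩ := isConj_iff.1 (alternatingGroup.isThreeCycle_isConj
    (σ := ⟨c, hc.mem_alternatingGroup⟩) (τ := ⟨d, IsThreeCycle.mem_alternatingGroup hd⟩)
    (by simpa using hn) hc hd)
  have := hN g g.2 c hcN
  have hg' := congrArg Subtype.val hg
  simp only [Subgroup.coe_mul, Subgroup.coe_inv] at hg'
  rwa [hg'] at this

/-- The alternating group is perfect for n ≥ 5, so taking derived subgroups does not shrink the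
action on the letters below it. -/
theorem alternatingGroup_le_map_commutator (hn : 5 ≤ n) {H : Subgroup (TreeAut n)}
    (hH : alternatingGroup (Fin n) ≤ H.map root) :
    alternatingGroup (Fin n) ≤ (⁅H, H⁆ : Subgroup (TreeAut n)).map root := by
  rw [Subgroup.map_commutator]
  refine le_trans (le_of_eq ?_) (Subgroup.commutator_mono hH hH)
  exact (commutator_alternatingGroup_eq_self (by simpa using hn)).symm

end HanoiTree

namespace HanoiTree

variable {n : ℕ}

/-! ### The branching structure -/

open Equiv Equiv.Perm
open scoped commutatorElement

/-- `u` is the section at `x` of an element of `G n` that fixes the letters and whose sections at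
all letters other than `x`, `y`, `z` are trivial. -/
def IsSectionIn (x y z : Fin n) (u : TreeAut n) : Prop :=
  ∃ f ∈ G n, root f = 1 ∧ (∀ v, v ≠ x → v ≠ y → v ≠ z → sec f v = 1) ∧ sec f x = u

theorem IsSectionIn.swap {x y z : Fin n} {u : TreeAut n} (h : IsSectionIn x y z u) :
    IsSectionIn x z y u := by
  obtain ⟨f, hf, h1, h2, h3⟩ := h
  exact ⟨f, hf, h1, fun v a b c => h2 v a c b, h3⟩

theorem IsSectionIn.conj {x y z : Fin n} {u e : TreeAut n} (h : IsSectionIn x y z u)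
    (he : e ∈ G n) :
    IsSectionIn (root e x) (root e y) (root e z) (sec e x * u * (sec e x)⁻¹) := by
  obtain ⟨f, hf, h1, h2, rfl⟩ := h
  refine ⟨e * f * e⁻¹, mul_mem (mul_mem he hf) (inv_mem he), by simp [h1], fun v hx hy hz => ?_, ?_⟩
  · obtain ⟨v, rfl⟩ := (root e).surjective v
    rw [sec_conj _ _ (by rw [h1]; rfl), h2 v (by rintro rfl; exact hx rfl)
      (by rintro rfl; exact hy rfl) (by rintro rfl; exact hz rfl)]
    simp
  · rw [sec_conj _ _ (by rw [h1]; rfl)]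

theorem IsSectionIn.mul {x y z : Fin n} {u v : TreeAut n} (hu : IsSectionIn x y z u)
    (hv : IsSectionIn x y z v) : IsSectionIn x y z (u * v) := by
  obtain ⟨f, hf, h1, h2, rfl⟩ := hu
  obtain ⟨g, hg, k1, k2, rfl⟩ := hv
  refine ⟨f * g, mul_mem hf hg, by simp [h1, k1], fun w a b c => ?_, ?_⟩
  · rw [sec_mul, k1, Equiv.Perm.one_apply, h2 w a b c, k2 w a b c, one_mul]
  · rw [sec_mul, k1, Equiv.Perm.one_apply]

theorem IsSectionIn.inv {x y z : Fin n} {u : TreeAut n} (hu : IsSectionIn x y z u) :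
    IsSectionIn x y z u⁻¹ := by
  obtain ⟨f, hf, h1, h2, rfl⟩ := hu
  refine ⟨f⁻¹, inv_mem hf, by simp [h1], fun w a b c => ?_, ?_⟩
  · rw [sec_inv, h1, inv_one, Equiv.Perm.one_apply, h2 w a b c, inv_one]
  · rw [sec_inv, h1, inv_one, Equiv.Perm.one_apply]

theorem isSectionIn_one (x y z : Fin n) : IsSectionIn x y z (1 : TreeAut n) :=
  ⟨1, one_mem _, map_one _, fun v _ _ _ => sec_one v, sec_one x⟩

theorem sec_gen_pow {j v : Fin n} (hv : v ≠ j) (k : ℕ) : sec (gen j ^ k) v = 1 := by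
  induction k generalizing v with
  | zero => simp [sec_one]
  | succ k ih =>
    have h : sigma j v ≠ j := fun h => hv ((sigma j).injective (h.trans (sigma_self j).symm))
    rw [pow_succ, sec_mul, root_gen, ih h, sec_gen, if_neg hv, one_mul]

/-- Self-replication. A generator a_i is its own section at i; a power of a third generator a_j
carries i to x with trivial section there, so conjugating by it moves a_i unchanged to x. -/
theorem exists_mem_sec_eq (hn : 3 ≤ n) (x : Fin n) {g : TreeAut n} (hg : g ∈ G n) :
    ∃ w ∈ G n, root w x = x ∧ sec w x = g := by
  induction hg using Subgroup.closure_induction with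
  | mem g hg =>
    obtain ⟨i, rfl⟩ := hg
    by_cases hix : i = x
    · subst hix
      exact ⟨gen i, gen_mem i, by rw [root_gen, sigma_self], by rw [sec_gen, if_pos rfl]⟩
    · obtain ⟨j, hji, hjx⟩ := exists_mem_ne hn i x
      obtain ⟨k, hk⟩ := exists_pow_sigma hn hji.symm hjx.symm
      have hr : root (gen j ^ k) i = x := by rw [map_pow, root_gen, hk]
      have hi : root (gen i) i = i := by rw [root_gen, sigma_self]
      refine ⟨gen j ^ k * gen i * (gen j ^ k)⁻¹, mul_mem (mul_mem (pow_mem (gen_mem j) k)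
        (gen_mem i)) (inv_mem (pow_mem (gen_mem j) k)), ?_, ?_⟩
      · rw [map_mul, map_mul, map_inv, Equiv.Perm.mul_apply, Equiv.Perm.mul_apply,
          show (root (gen j ^ k))⁻¹ x = i from (Equiv.symm_apply_eq _).2 hr.symm, hi, hr]
      · rw [← hr, sec_conj _ _ hi, sec_gen_pow hji.symm, sec_gen, if_pos rfl]
        simp
  | one => exact ⟨1, one_mem _, by simp, sec_one x⟩
  | mul g h _ _ hg hh =>
    obtain ⟨v, hv, h1, h2⟩ := hg
    obtain ⟨w, hw, h3, h4⟩ := hh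
    exact ⟨v * w, mul_mem hv hw, by simp [h3, h1], by rw [sec_mul, h3, h2, h4]⟩
  | inv g _ hg =>
    obtain ⟨v, hv, h1, h2⟩ := hg
    have h3 : (root v)⁻¹ x = x := (Equiv.symm_apply_eq _).2 h1.symm
    exact ⟨v⁻¹, inv_mem hv, by rw [map_inv, h3], by rw [sec_inv, h3, h2]⟩

theorem sec_mem {g : TreeAut n} (hg : g ∈ G n) (x : Fin n) : sec g x ∈ G n := by
  induction hg using Subgroup.closure_induction generalizing x with
  | mem g hg =>
    obtain ⟨i, rfl⟩ := hg
    rw [sec_gen]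
    split
    · exact gen_mem i
    · exact one_mem _
  | one => rw [sec_one]; exact one_mem _
  | mul g h _ _ hg hh => rw [sec_mul]; exact mul_mem (hg _) (hh _)
  | inv g _ hg => rw [sec_inv]; exact inv_mem (hg _)

/-- `G n` contains an element acting on the letters as a 3-cycle, with trivial sections off the
support of this 3-cycle. -/
theorem exists_threeCycle_section (hn : 3 ≤ n) : ∃ t ∈ G n, ∃ a b c : Fin n,
    a ≠ b ∧ a ≠ c ∧ b ≠ c ∧ root t = swap b c * swap a c ∧ sec t a = 1 ∧ sec t c * sec t b = t ∧
    ∀ v, v ≠ a → v ≠ b → v ≠ c → sec t v = 1 := by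
  obtain ⟨a, b, c, hab, hac, hbc, h⟩ := exists_sigma_mul_inv hn
  -- The only nontrivial sections are a_a at c and a_b⁻¹ at b. Their product in this order is t
  -- again, which is what makes t³ have section t at a.
  have hsec : ∀ v, sec (gen a * (gen b)⁻¹) v =
      (if v = c then gen a else 1) * (if v = b then gen b else 1)⁻¹ := by
    intro v
    have h1 : (sigma b)⁻¹ v = a ↔ v = c := by
      have hc : (sigma b)⁻¹ c = a := by
        refine (sigma a).injective ?_
        rw [sigma_self, ← Equiv.Perm.mul_apply, h]
        simp [swap_apply_of_ne_of_ne hab hac]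
      rw [← hc]
      exact (sigma b)⁻¹.injective.eq_iff
    have h2 : (sigma b)⁻¹ v = b ↔ v = b := by
      rw [Equiv.Perm.inv_eq_iff_eq, sigma_self]
    rw [sec_mul, sec_inv, map_inv, root_gen, sec_gen, sec_gen]
    simp only [h1, h2]
  refine ⟨gen a * (gen b)⁻¹, mul_mem (gen_mem a) (inv_mem (gen_mem b)), a, b, c, hab, hac, hbc,
    by simp [root_gen, h], by simp [hsec, hab, hac], by simp [hsec, hbc, hbc.symm], ?_⟩
  intro v _ hb hc
  simp [hsec, hb, hc]

theorem exists_threeCycle (hn : 5 ≤ n) {p q r : Fin n} (hpq : p ≠ q) (hpr : p ≠ r) (hqr : q ≠ r) :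
    ∃ f ∈ G n, root f p = q ∧ root f q = r ∧ root f r = p ∧
      ∀ v, v ≠ p → v ≠ q → v ≠ r → root f v = v ∧ sec f v = 1 := by
  obtain ⟨t, ht, a, b, c, hab, hac, hbc, h, -, -, hs⟩ :=
    exists_threeCycle_section (n := n) (by omega)
  obtain ⟨g, hg, rfl, rfl, rfl⟩ :=
    exists_root_triple hn (alternatingGroup_le_map_root hn) hab hac hbc hpq hpr hqr
  have hrt : ∀ v, root (g * t * g⁻¹) (root g v) = root g (root t v) := fun v => by
    rw [map_mul, map_mul, map_inv, Equiv.Perm.mul_apply, Equiv.Perm.mul_apply]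
    congr 2
    exact (root g).symm_apply_apply v
  refine ⟨g * t * g⁻¹, mul_mem (mul_mem hg ht) (inv_mem hg), ?_, ?_, ?_, fun v h1 h2 h3 => ?_⟩
  · rw [hrt, h]; simp
  · rw [hrt, h]; simp [swap_apply_of_ne_of_ne hab.symm hbc]
  · rw [hrt, h]; simp [swap_apply_of_ne_of_ne hab hac]
  · obtain ⟨v, rfl⟩ := (root g).surjective v
    have h1 : v ≠ a := by rintro rfl; exact h1 rfl
    have h2 : v ≠ b := by rintro rfl; exact h2 rfl
    have h3 : v ≠ c := by rintro rfl; exact h3 rfl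
    have hv : root t v = v := by
      rw [h, Equiv.Perm.mul_apply, swap_apply_of_ne_of_ne h1 h3, swap_apply_of_ne_of_ne h2 h3]
    exact ⟨by rw [hrt, hv], by rw [sec_conj _ _ hv, hs v h1 h2 h3]; simp⟩

/-- Conjugate by a 3-cycle on p, q, r whose section at x is trivial: this moves the auxiliary
letters and leaves the section at x untouched. -/
theorem IsSectionIn.replace (hn : 5 ≤ n) {x p q r : Fin n} {u : TreeAut n} (hxp : x ≠ p)
    (hxq : x ≠ q) (hxr : x ≠ r) (hpq : p ≠ q) (hpr : p ≠ r) (h : IsSectionIn x p q u) :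
    IsSectionIn x p r u := by
  by_cases hqr : q = r
  · rwa [← hqr]
  obtain ⟨f, hf, h1, h2, -, h4⟩ := exists_threeCycle hn hpq.symm hqr hpr
  obtain ⟨h5, h6⟩ := h4 x hxq hxp hxr
  have := (h.conj hf).swap
  rwa [h1, h2, h5, h6, one_mul, inv_one, mul_one] at this

theorem IsSectionIn.of_ne (hn : 5 ≤ n) {x p q y z : Fin n} {u : TreeAut n} (hxp : x ≠ p)
    (hxq : x ≠ q) (hpq : p ≠ q) (hxy : x ≠ y) (hxz : x ≠ z) (hyz : y ≠ z)
    (h : IsSectionIn x p q u) : IsSectionIn x y z u := by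
  by_cases hpz : p = z
  · subst hpz
    exact (h.replace hn hxp hxq hxy hpq hyz.symm).swap
  · exact ((h.replace hn hxp hxq hxz hpq hpz).swap.replace hn hxz hxp hxy (Ne.symm hpz)
      hyz.symm).swap

/-- The elements of `G n` that are, for all distinct letters `x`, `y`, `z`, the section at `x` of
an element of `G n` fixing the letters whose sections off `x`, `y`, `z` are trivial. -/
def tripleGroup (n : ℕ) : Subgroup (TreeAut n) where
  carrier := {u | u ∈ G n ∧ ∀ x y z : Fin n, x ≠ y → x ≠ z → y ≠ z → IsSectionIn x y z u}
  one_mem' := ⟨one_mem _, fun x y z _ _ _ => isSectionIn_one x y z⟩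
  mul_mem' hu hv := ⟨mul_mem hu.1 hv.1, fun x y z h1 h2 h3 =>
    (hu.2 x y z h1 h2 h3).mul (hv.2 x y z h1 h2 h3)⟩
  inv_mem' hu := ⟨inv_mem hu.1, fun x y z h1 h2 h3 => (hu.2 x y z h1 h2 h3).inv⟩

theorem tripleGroup_le : tripleGroup n ≤ G n := fun _ hu => hu.1

theorem conj_mem_tripleGroup (hn : 3 ≤ n) {g u : TreeAut n} (hg : g ∈ G n)
    (hu : u ∈ tripleGroup n) : g * u * g⁻¹ ∈ tripleGroup n := by
  refine ⟨mul_mem (mul_mem hg hu.1) (inv_mem hg), fun x y z hxy hxz hyz => ?_⟩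
  obtain ⟨w, hw, hwx, rfl⟩ := exists_mem_sec_eq hn x hg
  obtain ⟨y, rfl⟩ := (root w).surjective y
  obtain ⟨z, rfl⟩ := (root w).surjective z
  have := (hu.2 x y z (by rintro rfl; exact hxy hwx.symm) (by rintro rfl; exact hxz hwx.symm)
    (by rintro rfl; exact hyz rfl)).conj hw
  rwa [hwx] at this

theorem exists_mem_tripleGroup (hn : 5 ≤ n) : ∃ t ∈ tripleGroup n, (root t).IsThreeCycle := by
  obtain ⟨t, ht, a, b, c, hab, hac, hbc, h, hsa, hst, hs⟩ :=
    exists_threeCycle_section (n := n) (by omega)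
  have ha : root t a = b := by rw [h]; simp
  have hb : root t b = c := by rw [h]; simp [swap_apply_of_ne_of_ne hab.symm hbc]
  have hc : root t c = a := by rw [h]; simp [swap_apply_of_ne_of_ne hab hac]
  have hv : ∀ v, v ≠ a → v ≠ b → v ≠ c → root t v = v := fun v h1 h2 h3 => by
    rw [h, Equiv.Perm.mul_apply, swap_apply_of_ne_of_ne h1 h3, swap_apply_of_ne_of_ne h2 h3]
  have base : IsSectionIn a b c t := by
    refine ⟨t * t * t, mul_mem (mul_mem ht ht) ht, ?_, fun v h1 h2 h3 => ?_, ?_⟩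
    · ext1 v
      simp only [map_mul, Equiv.Perm.mul_apply, Equiv.Perm.one_apply]
      by_cases h1 : v = a
      · rw [h1, ha, hb, hc]
      by_cases h2 : v = b
      · rw [h2, hb, hc, ha]
      by_cases h3 : v = c
      · rw [h3, hc, ha, hb]
      rw [hv v h1 h2 h3, hv v h1 h2 h3, hv v h1 h2 h3]
    · rw [sec_mul, sec_mul, hv v h1 h2 h3, hv v h1 h2 h3, hs v h1 h2 h3]; simp
    · rw [sec_mul, sec_mul, ha, hb, hsa, mul_one, hst]
  refine ⟨t, ⟨ht, fun x y z hxy hxz hyz => ?_⟩, ?_⟩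
  -- Moving a to x by g conjugates t by the section of g at a. A further w fixing x, with the
  -- inverse section there, undoes this; w may displace the other two letters, which
  -- `IsSectionIn.of_ne` repairs.
  · obtain ⟨g, hg, rfl, -⟩ := exists_root_triple hn (alternatingGroup_le_map_root hn) hab hac hbc
      hxy hxz hyz
    have hsg : sec g a ∈ G n := sec_mem hg a
    obtain ⟨w, hw, hwx, hws⟩ := exists_mem_sec_eq (n := n) (by omega) (root g a) (inv_mem hsg)
    have := base.conj (mul_mem hw hg)
    rw [sec_mul, hws, inv_mul_cancel, one_mul, inv_one, mul_one, map_mul, Equiv.Perm.mul_apply,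
      hwx] at this
    refine this.of_ne hn ?_ ?_ ?_ hxy hxz hyz
    · exact fun h => hab ((root g).injective ((root w).injective (hwx.trans h)))
    · exact fun h => hac ((root g).injective ((root w).injective (hwx.trans h)))
    · exact fun h => hbc ((root g).injective ((root w).injective (h)))
  · rw [h, swap_comm b c, swap_comm a c]
    exact isThreeCycle_swap_mul_swap_same hbc.symm hac.symm hab.symm

/-- When both factors fix the letters, commutators are taken letter by letter, and vanish wherever
one factor has trivial section. -/
theorem commutator_eq_iota {f g : TreeAut n} {x : Fin n} (hf : root f = 1) (hg : root g = 1)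
    (h : ∀ v, v ≠ x → sec f v = 1 ∨ sec g v = 1) : ⁅f, g⁆ = iota x ⁅sec f x, sec g x⁆ := by
  rw [← ofSections_sec hf, ← ofSections_sec hg, ← map_commutatorElement, iota_apply]
  simp only [sec_ofSections]
  congr 1
  funext v
  by_cases hv : v = x
  · subst hv
    rw [Pi.mulSingle_eq_same]
    rfl
  · rw [Pi.mulSingle_eq_of_ne hv]
    change ⁅sec f v, sec g v⁆ = 1
    rcases h v hv with h | h <;> simp [h]

theorem commutator_tripleGroup_le (hn : 5 ≤ n) (x : Fin n) :
    ⁅tripleGroup n, tripleGroup n⁆ ≤ (G n).comap (iota x) := by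
  have ex : ∀ s : Finset (Fin n), s.card ≤ 4 → ∃ c, c ∉ s := fun s hs => by
    obtain ⟨c, -, hc⟩ := Finset.exists_mem_notMem_of_card_lt_card
      (show s.card < (Finset.univ : Finset (Fin n)).card by simp; omega)
    exact ⟨c, hc⟩
  -- Five distinct letters are needed: the supports {x, y, z} and {x, y', z'} must meet only in x.
  obtain ⟨y, hy⟩ := ex {x} (by simp)
  obtain ⟨z, hz⟩ := ex {x, y} (Finset.card_le_two.trans (by omega))
  obtain ⟨y', hy'⟩ := ex {x, y, z} (Finset.card_le_three.trans (by omega))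
  obtain ⟨z', hz'⟩ := ex {x, y, z, y'} Finset.card_le_four
  simp only [Finset.mem_insert, Finset.mem_singleton, not_or] at hy hz hy' hz'
  rw [Subgroup.commutator_le]
  intro u hu v hv
  obtain ⟨f, hf, f1, f2, rfl⟩ := hu.2 x y z (Ne.symm hy) (Ne.symm hz.1) (Ne.symm hz.2)
  obtain ⟨g, hg, g1, g2, rfl⟩ := hv.2 x y' z' (Ne.symm hy'.1) (Ne.symm hz'.1)
    (Ne.symm hz'.2.2.2)
  rw [Subgroup.mem_comap, ← commutator_eq_iota f1 g1]
  · rw [commutatorElement_def]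
    exact mul_mem (mul_mem (mul_mem hf hg) (inv_mem hf)) (inv_mem hg)
  · intro w hw
    by_cases h : w = y ∨ w = z
    · refine Or.inr (g2 w hw ?_ ?_)
      · rcases h with rfl | rfl
        · exact Ne.symm hy'.2.1
        · exact Ne.symm hy'.2.2
      · rcases h with rfl | rfl
        · exact Ne.symm hz'.2.1
        · exact Ne.symm hz'.2.2.1
    · rw [not_or] at h
      exact Or.inl (f2 w hw h.1 h.2)

/-- If `N` is normalized by `G n`, moves the letters as the alternating group does, and can be
planted into `G n` below every letter, then the derived subgroup of `N` can be planted into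
itself. -/
theorem commutator_le_comap_iota (hn : 5 ≤ n) {N : Subgroup (TreeAut n)}
    (hconj : ∀ g ∈ G n, ∀ u ∈ N, g * u * g⁻¹ ∈ N) (hN : alternatingGroup (Fin n) ≤ N.map root)
    (hiota : ∀ x, N ≤ (G n).comap (iota x)) (x : Fin n) : ⁅N, N⁆ ≤ ⁅N, N⁆.comap (iota x) := by
  obtain ⟨y, hyx, -⟩ := exists_mem_ne (n := n) (by omega) x x
  obtain ⟨z, hzx, hzy⟩ := exists_mem_ne (n := n) (by omega) x y
  have key : ∀ y, y ≠ x → ∀ b ∈ N, ∃ f ∈ N, root f = 1 ∧ sec f x = b ∧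
      ∀ v, v ≠ x → v ≠ y → sec f v = 1 := by
    intro y hyx b hb
    obtain ⟨z, hzx, hzy⟩ := exists_mem_ne (n := n) (by omega) x y
    obtain ⟨h, hh, rfl, -⟩ := exists_root_triple hn hN hyx.symm hzx.symm hzy.symm hyx hzy.symm
      hzx.symm
    have hr : root (h * (iota x b)⁻¹ * h⁻¹) = 1 := by simp [root_iota]
    have hs : ∀ v, v ≠ root h x → sec (h * (iota x b)⁻¹ * h⁻¹) v = 1 := fun v hv => by
      rw [← map_inv, conj_iota, sec_iota, Pi.mulSingle_eq_of_ne hv]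
    -- This is the commutator of `iota x b` with h ∈ N, where h moves x to y. It lies in N because
    -- `iota x b` is in `G n` and so normalizes N; the price is a second section at y.
    refine ⟨iota x b * (h * (iota x b)⁻¹ * h⁻¹), ?_, ?_, ?_, fun v hvx hvy => ?_⟩
    · have := mul_mem (hconj _ (hiota x hb) h hh) (inv_mem hh)
      simpa only [mul_assoc] using this
    · rw [map_mul, root_iota, hr, one_mul]
    · rw [sec_mul, hr, Equiv.Perm.one_apply, hs x hyx.symm, sec_iota, Pi.mulSingle_eq_same, mul_one]
    · rw [sec_mul, hr, Equiv.Perm.one_apply, hs v hvy, sec_iota, Pi.mulSingle_eq_of_ne hvx, mul_one]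
  rw [Subgroup.commutator_le]
  intro b hb c hc
  obtain ⟨f, hf, f1, rfl, f2⟩ := key y hyx b hb
  obtain ⟨g, hg, g1, rfl, g2⟩ := key z hzx c hc
  rw [Subgroup.mem_comap, ← commutator_eq_iota f1 g1]
  · exact Subgroup.commutator_mem_commutator hf hg
  · intro v hv
    by_cases h : v = y
    · exact Or.inr (g2 v hv (by rw [h]; exact hzy.symm))
    · exact Or.inl (f2 v hv h)

theorem conj_mem_commutator {H : Subgroup (TreeAut n)} {g : TreeAut n}
    (h : ∀ u ∈ H, g * u * g⁻¹ ∈ H) : ∀ u ∈ ⁅H, H⁆, g * u * g⁻¹ ∈ ⁅H, H⁆ := by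
  have : ⁅H, H⁆ ≤ ⁅H, H⁆.comap (MulAut.conj g).toMonoidHom := by
    rw [Subgroup.commutator_le]
    intro a ha b hb
    rw [Subgroup.mem_comap, map_commutatorElement]
    exact Subgroup.commutator_mem_commutator (h a ha) (h b hb)
  exact fun u hu => this hu

/-- For `n ≥ 5`, the group `G n` has a subgroup that contains the product of its copies below the
letters and that acts on the letters at least as the alternating group. -/
theorem exists_branching_subgroup (hn : 5 ≤ n) : ∃ K ≤ G n,
    alternatingGroup (Fin n) ≤ K.map root ∧
      ∀ p : Fin n → TreeAut n, (∀ x, p x ∈ K) → ofSections p ∈ K := by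
  set T := tripleGroup n
  have hT : ∀ g ∈ G n, ∀ u ∈ T, g * u * g⁻¹ ∈ T := fun g hg u hu =>
    conj_mem_tripleGroup (by omega) hg hu
  have hTA : alternatingGroup (Fin n) ≤ T.map root := by
    obtain ⟨t, ht, h3⟩ := exists_mem_tripleGroup hn
    refine alternatingGroup_le_of_isThreeCycle_mem hn ?_ h3 ⟨t, ht, rfl⟩
    rintro g hg _ ⟨u, hu, rfl⟩
    obtain ⟨g, hgG, rfl⟩ := alternatingGroup_le_map_root hn hg
    exact ⟨g * u * g⁻¹, hT g hgG u hu, by simp⟩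
  have hle : ∀ {H : Subgroup (TreeAut n)}, H ≤ G n → ⁅H, H⁆ ≤ G n := fun {H} hH =>
    Subgroup.commutator_le.2 fun a ha b hb =>
      mul_mem (mul_mem (mul_mem (hH ha) (hH hb)) (inv_mem (hH ha))) (inv_mem (hH hb))
  have hN := alternatingGroup_le_map_commutator hn hTA
  -- The first derived subgroup can be planted into `G n`, the second into itself.
  refine ⟨⁅(⁅T, T⁆ : Subgroup (TreeAut n)), ⁅T, T⁆⁆, hle (hle tripleGroup_le),
    alternatingGroup_le_map_commutator hn hN, fun p hp => ?_⟩
  suffices p ∈ Subgroup.comap ofSections ⁅(⁅T, T⁆ : Subgroup (TreeAut n)), ⁅T, T⁆⁆ from this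
  refine Subgroup.pi_mem_of_mulSingle_mem p fun x => ?_
  exact commutator_le_comap_iota hn (fun g hg => conj_mem_commutator (hT g hg)) hN
    (commutator_tripleGroup_le hn) x (hp x)

end HanoiTree

namespace HanoiTree

variable {n : ℕ}

/-! ### Counting automorphisms modulo level stabilizers -/

open Finset
open scoped Nat

theorem levelStab_zero (n : ℕ) : levelStab n 0 = ⊤ := by
  refine (Subgroup.eq_top_iff' _).2 fun g u hu => ?_
  rw [List.length_eq_zero_iff.1 hu, g.smul_nil]

theorem mem_levelStab_succ {g : TreeAut n} {m : ℕ} :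
    g ∈ levelStab n (m + 1) ↔ root g = 1 ∧ ∀ x, sec g x ∈ levelStab n m := by
  constructor
  · intro hg
    have key : ∀ (x : Fin n) (w : List (Fin n)), w.length = m →
        root g x = x ∧ sec g x • w = w := fun x w hw => by
      have := hg (x :: w) (by simp [hw])
      rw [smul_cons] at this
      exact List.cons.inj this
    refine ⟨?_, fun x w hw => (key x w hw).2⟩
    ext1 x
    exact (key x (List.replicate m x) (by simp)).1
  · rintro ⟨h1, h2⟩ u hu
    match u with
    | [] => simp at hu
    | x :: w =>
      rw [smul_cons, h1, h2 x w (by simpa using hu)]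
      rfl

theorem inv_mul_mem_levelStab_succ {g h : TreeAut n} {m : ℕ} :
    g⁻¹ * h ∈ levelStab n (m + 1) ↔
      root g = root h ∧ ∀ x, (sec g x)⁻¹ * sec h x ∈ levelStab n m := by
  rw [mem_levelStab_succ, map_mul, map_inv, inv_mul_eq_one]
  refine and_congr_right fun hr => forall_congr' fun x => ?_
  rw [sec_mul, sec_inv, hr, show (root h)⁻¹ (root h x) = x from (root h).symm_apply_apply x]

instance (n m : ℕ) : Finite (TreeAut n ⧸ levelStab n m) :=
  have := levelStab_finiteIndex n m
  Subgroup.finite_quotient_of_finiteIndex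

theorem index_levelStab_succ_le (n m : ℕ) :
    (levelStab n (m + 1)).index ≤ n ! * (levelStab n m).index ^ n := by
  let ψ : TreeAut n ⧸ levelStab n (m + 1) →
      Equiv.Perm (Fin n) × (Fin n → TreeAut n ⧸ levelStab n m) :=
    fun q => (root q.out, fun x => (sec q.out x : TreeAut n ⧸ levelStab n m))
  have hψ : Function.Injective ψ := by
    intro q q' h
    rw [← q.out_eq', ← q'.out_eq']
    refine QuotientGroup.eq.2 (inv_mul_mem_levelStab_succ.2 ⟨(Prod.ext_iff.1 h).1, fun x => ?_⟩)
    exact QuotientGroup.eq.1 (congrFun (Prod.ext_iff.1 h).2 x)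
  have := Nat.card_le_card_of_injective ψ hψ
  rwa [Nat.card_prod, Nat.card_fun, Nat.card_perm, Nat.card_fin] at this

theorem index_levelStab_le (n m : ℕ) :
    (levelStab n m).index ≤ n ! ^ ∑ i ∈ range m, n ^ i := by
  induction m with
  | zero => simp [levelStab_zero]
  | succ m ih =>
    calc (levelStab n (m + 1)).index ≤ n ! * (levelStab n m).index ^ n :=
          index_levelStab_succ_le n m
      _ ≤ n ! * (n ! ^ ∑ i ∈ range m, n ^ i) ^ n := by gcongr
      _ = _ := by rw [geom_sum_succ, ← pow_mul, mul_comm n, pow_succ, mul_comm]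

/-- A subgroup that contains the product of its copies below the letters and acts on the letters
at least as the alternating group has many elements modulo each level stabilizer. -/
theorem exists_family_of_branching {K : Subgroup (TreeAut n)}
    (hA : alternatingGroup (Fin n) ≤ K.map root)
    (hK : ∀ p : Fin n → TreeAut n, (∀ x, p x ∈ K) → ofSections p ∈ K) (m : ℕ) :
    ∃ (ι : Type) (_ : Finite ι) (f : ι → TreeAut n), (∀ i, f i ∈ K) ∧
      (∀ i j, (f i)⁻¹ * f j ∈ levelStab n m → i = j) ∧
      Nat.card ι = Nat.card (alternatingGroup (Fin n)) ^ ∑ i ∈ range m, n ^ i := by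
  induction m with
  | zero => exact ⟨Unit, inferInstance, fun _ => 1, fun _ => one_mem _, fun _ _ _ => rfl, by simp⟩
  | succ m ih =>
    obtain ⟨ι, _, f, hf, hinj, hcard⟩ := ih
    have hrep : ∀ a : alternatingGroup (Fin n), ∃ g ∈ K, root g = a := fun a => hA a.2
    choose r hr hra using hrep
    -- Choose the even action on the letters and the n sections independently.
    refine ⟨alternatingGroup (Fin n) × (Fin n → ι), inferInstance,
      fun p => r p.1 * ofSections fun x => f (p.2 x),
      fun p => mul_mem (hr _) (hK _ fun x => hf _), ?_, ?_⟩
    · rintro ⟨a, k⟩ ⟨b, l⟩ h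
      obtain ⟨h1, h2⟩ := inv_mul_mem_levelStab_succ.1 h
      simp only [map_mul, root_ofSections, mul_one, hra] at h1
      obtain rfl := Subtype.ext h1
      refine Prod.ext rfl (funext fun x => hinj _ _ ?_)
      simpa [sec_mul, root_ofSections, sec_ofSections, mul_assoc] using h2 x
    · rw [Nat.card_prod, Nat.card_fun, hcard, Nat.card_fin, geom_sum_succ, ← pow_mul, mul_comm n,
        pow_succ, mul_comm]

end HanoiTree

namespace HanoiTree

variable {n : ℕ}

/-! ### Topology, Haar measure and Hausdorff dimension -/

open Filter Topology MeasureTheory MeasureTheory.Measure Finset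
open scoped ENNReal NNReal Nat

theorem edist_le_of_mem {g h : TreeAut n} {m : ℕ} (H : g⁻¹ * h ∈ levelStab n m) :
    edist g h ≤ ((levelStab n m).index : ℝ≥0∞)⁻¹ := by
  change treeDist g h ≤ _
  unfold treeDist
  split
  · exact zero_le
  · exact iInf₂_le m H

/-- If g and h already disagree at level m+1, every level at which they agree is at most m, so no
smaller value enters the infimum. -/
theorem inv_index_le_edist {g h : TreeAut n} {m : ℕ} (H : g⁻¹ * h ∉ levelStab n (m + 1)) :
    ((levelStab n m).index : ℝ≥0∞)⁻¹ ≤ edist g h := by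
  change _ ≤ treeDist g h
  have hgh : g ≠ h := by
    rintro rfl
    exact H (by simp [one_mem])
  rw [treeDist, if_neg hgh]
  refine le_iInf₂ fun k hk => ENNReal.inv_le_inv.2 ?_
  have hkm : k ≤ m := by
    by_contra! hlt
    exact H (levelStab_antitone n hlt hk)
  have := levelStab_finiteIndex n m
  exact_mod_cast Subgroup.index_antitone (levelStab_antitone n hkm)

theorem isOpen_levelStab (n m : ℕ) : IsOpen (levelStab n m : Set (TreeAut n)) := by
  have hpos : (0 : ℝ≥0∞) < ((levelStab n m).index : ℝ≥0∞)⁻¹ :=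
    ENNReal.inv_pos.2 (ENNReal.natCast_ne_top _)
  refine Subgroup.isOpen_of_mem_nhds _ (g := 1)
    (Filter.mem_of_superset (Metric.eball_mem_nhds 1 hpos) fun h hh => ?_)
  by_contra hcon
  have hm : (1 : TreeAut n)⁻¹ * h ∉ levelStab n (m + 1) := fun hmem => by
    rw [inv_one, one_mul] at hmem
    exact hcon (levelStab_antitone n m.le_succ hmem)
  rw [Metric.mem_eball, edist_comm] at hh
  exact absurd (inv_index_le_edist hm) (not_le.2 hh)

theorem exists_eventually_eq_of_finite {X α : Type*} [Finite α] (F : Ultrafilter X) (f : X → α) :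
    ∃ a, ∀ᶠ x in (F : Filter X), f x = a := by
  obtain ⟨a, ha⟩ := (F.map f).eq_pure_of_finite
  refine ⟨a, ?_⟩
  have : {a} ∈ F.map f := by rw [ha]; exact Filter.mem_pure.2 rfl
  exact this

/-- An ultrafilter picks one coset of each Stab(m), there being finitely many; these choices define
the action of the limit level by level. The hypothesis `hI` makes closeness on deep levels the same
as closeness in the metric. -/
theorem compactSpace_treeAut
    (hI : Tendsto (fun m => ((levelStab n m).index : ℝ≥0∞)⁻¹) atTop (𝓝 0)) :
    CompactSpace (TreeAut n) := by
  refine ⟨isCompact_iff_ultrafilter_le_nhds.2 fun F _ => ?_⟩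
  have hlim : ∀ m, ∃ q : TreeAut n, ∀ᶠ g in (F : Filter (TreeAut n)), q⁻¹ * g ∈ levelStab n m := by
    intro m
    obtain ⟨q, hq⟩ := exists_eventually_eq_of_finite F
      (fun g => (g : TreeAut n ⧸ levelStab n m))
    refine ⟨q.out, hq.mono fun g hg => ?_⟩
    rw [← QuotientGroup.eq, hg]
    exact q.out_eq'
  choose q hq using hlim
  have hsmul : ∀ u : List (Fin n), ∀ᶠ g in (F : Filter (TreeAut n)), g • u = q u.length • u :=
    fun u => (hq u.length).mono fun g hg => by
      have := hg u rfl
      rwa [mul_smul, inv_smul_eq_iff] at this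
  let L : TreeAut n :=
    ⟨{ toFun := fun u => q u.length • u
       invFun := fun u => (q u.length)⁻¹ • u
       left_inv := fun u => by
        change (q (q u.length • u).length)⁻¹ • q u.length • u = u
        rw [TreeAut.length_smul, inv_smul_smul]
       right_inv := fun u => by
        change q ((q u.length)⁻¹ • u).length • (q u.length)⁻¹ • u = u
        rw [TreeAut.length_smul, smul_inv_smul] },
      TreeAut.smul_nil _, fun u v => by
        -- u and v may lie on different levels, but one automorphism g agrees with the limit on
        -- both.
        obtain ⟨g, hu, hv⟩ := ((hsmul u).and (hsmul v)).exists
        change (tree n).Adj (q u.length • u) (q v.length • v) ↔ _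
        rw [← hu, ← hv, g.adj_smul]⟩
  have hL : ∀ u : List (Fin n), L • u = q u.length • u := fun _ => rfl
  refine ⟨L, trivial, ?_⟩
  rw [(Metric.nhds_basis_eball (x := L)).ge_iff]
  intro ε hε
  obtain ⟨m, hm⟩ := (hI.eventually (gt_mem_nhds hε)).exists
  filter_upwards [hq m] with g hg
  rw [Metric.mem_eball, edist_comm]
  refine lt_of_le_of_lt (edist_le_of_mem fun u hu => ?_) hm
  have := hg u hu
  rw [mul_smul, inv_smul_eq_iff] at this
  rw [mul_smul, inv_smul_eq_iff, this, hL, hu]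

/-- Cover by the cosets of Stab(m): their number is the index and their diameters are at most its
inverse, so the 1-dimensional measure of the whole space is at most 1. -/
theorem dimH_le_one (hI : Tendsto (fun m => ((levelStab n m).index : ℝ≥0∞)⁻¹) atTop (𝓝 0))
    (s : Set (TreeAut n)) : dimH s ≤ 1 := by
  let : MeasurableSpace (TreeAut n) := borel _
  have : BorelSpace (TreeAut n) := ⟨rfl⟩
  refine (dimH_mono (Set.subset_univ s)).trans ?_
  have hμ : μH[((1 : ℝ≥0) : ℝ)] (Set.univ : Set (TreeAut n)) ≤ 1 := by
    let : ∀ m, Fintype (TreeAut n ⧸ levelStab n m) := fun m => Fintype.ofFinite _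
    have hdiam : ∀ m (q : TreeAut n ⧸ levelStab n m),
        Metric.ediam {g : TreeAut n | (g : TreeAut n ⧸ levelStab n m) = q} ≤
          ((levelStab n m).index : ℝ≥0∞)⁻¹ := fun m q =>
      Metric.ediam_le fun g hg h hh => edist_le_of_mem (QuotientGroup.eq.1 (hg.trans hh.symm))
    have hcover : ∀ m, (Set.univ : Set (TreeAut n)) ⊆
        ⋃ q : TreeAut n ⧸ levelStab n m, {g : TreeAut n | (g : TreeAut n ⧸ levelStab n m) = q} :=
      fun m g _ => Set.mem_iUnion.2 ⟨(g : TreeAut n ⧸ levelStab n m), rfl⟩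
    refine (hausdorffMeasure_le_liminf_sum _ _ _ hI
      (fun m (q : TreeAut n ⧸ levelStab n m) => {g | (g : TreeAut n ⧸ levelStab n m) = q})
      (.of_forall hdiam) (.of_forall hcover)).trans ?_
    refine (liminf_le_liminf (v := fun _ => 1) (.of_forall fun m => ?_)).trans_eq (liminf_const _)
    calc _ ≤ ∑ _q : TreeAut n ⧸ levelStab n m, ((levelStab n m).index : ℝ≥0∞)⁻¹ := by
          refine Finset.sum_le_sum fun q _ => ?_
          rw [NNReal.coe_one, ENNReal.rpow_one]
          exact hdiam m q
      _ ≤ 1 := by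
          rw [Finset.sum_const, Finset.card_univ, ← Nat.card_eq_fintype_card, nsmul_eq_mul]
          exact ENNReal.mul_inv_le_one _
  exact dimH_le_of_hausdorffMeasure_ne_top (ne_top_of_le_ne_top ENNReal.one_ne_top hμ)

/-- Lower bound for the Hausdorff dimension of a closed subgroup in terms of the number of its
elements modulo the level stabilizers. -/
theorem le_dimH_of_family [CompactSpace (TreeAut n)] {H : Subgroup (TreeAut n)}
    (hH : IsClosed (H : Set (TreeAut n))) {s : ℝ≥0} {k : ℕ → ℕ}
    (hk : Tendsto (fun m => (k m : ℝ≥0∞)⁻¹) atTop (𝓝 0))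
    (hks : ∀ m, ((levelStab n m).index : ℝ≥0∞) ^ (s : ℝ) ≤ k m)
    (hfam : ∀ m, ∃ (ι : Type) (_ : Finite ι) (f : ι → TreeAut n), (∀ i, f i ∈ H) ∧
      (∀ i j, (f i)⁻¹ * f j ∈ levelStab n m → i = j) ∧ Nat.card ι = k m) :
    (s : ℝ≥0∞) ≤ dimH (H : Set (TreeAut n)) := by
  have : CompactSpace H := hH.isClosedEmbedding_subtypeVal.compactSpace
  let : MeasurableSpace H := borel _
  have : BorelSpace H := ⟨rfl⟩
  let μ : Measure H := haarMeasure ⊤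
  have hμ : μ Set.univ = 1 := haarMeasure_self (K₀ := (⊤ : TopologicalSpace.PositiveCompacts H))
  let C : ℕ → H → Set H := fun m g => {h | ((g⁻¹ * h : H) : TreeAut n) ∈ levelStab n m}
  have hCopen : ∀ m g, IsOpen (C m g) := fun m g =>
    (isOpen_levelStab n m).preimage (continuous_subtype_val.comp (continuous_const_mul g⁻¹))
  have hCμ : ∀ m g, μ (C m g) = μ (C m 1) := fun m g => by
    rw [← measure_preimage_mul μ g⁻¹ (C m 1)]
    simp [C]
  -- By invariance all these cosets have equal mass, and the family gives `k m` disjoint ones in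
  -- total mass 1.
  have hC : ∀ m g, μ (C m g) ≤ (k m : ℝ≥0∞)⁻¹ := by
    intro m g
    obtain ⟨ι, _, f, hf, hinj, hcard⟩ := hfam m
    let := Fintype.ofFinite ι
    have hdisj : Pairwise (Function.onFun Disjoint fun i => C m ⟨f i, hf i⟩) := by
      intro i j hij
      refine Set.disjoint_left.2 fun h hi hj => hij (hinj i j ?_)
      have hi : (f i)⁻¹ * h ∈ levelStab n m := hi
      have hj : (f j)⁻¹ * h ∈ levelStab n m := hj
      simpa [mul_assoc] using mul_mem hi (inv_mem hj)
    have hsum := tsum_measure_le_measure_univ (μ := μ)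
      (fun i => (hCopen m ⟨f i, hf i⟩).measurableSet.nullMeasurableSet)
      (fun i j hij => (hdisj hij).aedisjoint)
    simp only [hCμ m ⟨f _, hf _⟩] at hsum
    rw [tsum_fintype, Finset.sum_const, Finset.card_univ, ← Nat.card_eq_fintype_card, hcard, hμ,
      nsmul_eq_mul] at hsum
    rw [hCμ, ENNReal.le_inv_iff_mul_le, mul_comm]
    exact hsum
  -- Mass distribution: μ(S) ≤ diam(S)^s for every S. Let m+1 be the first level at which S is not
  -- in a single coset; S then has mass at most 1/`k m` and diameter at least the inverse index of
  -- Stab(m). If no such level exists, S is null.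
  have hle : μ ≤ μH[(s : ℝ)] := by
    refine le_hausdorffMeasure _ μ 1 one_pos fun S _ => ?_
    rcases S.eq_empty_or_nonempty with rfl | ⟨g, hg⟩
    · simp
    by_cases hall : ∀ m, S ⊆ C m g
    · have : μ S ≤ 0 := ge_of_tendsto' hk fun m => (measure_mono (hall m)).trans (hC m g)
      exact this.trans zero_le
    · push Not at hall
      classical
      obtain ⟨m, hm⟩ : ∃ m, Nat.find hall = m + 1 := by
        refine Nat.exists_eq_succ_of_ne_zero fun h0 => ?_
        have := Nat.find_spec hall
        rw [h0] at this
        exact this fun h _ => by simp [C, levelStab_zero]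
      have hsub : S ⊆ C m g := by
        have := Nat.find_min hall (m := m) (by omega)
        rwa [not_not] at this
      obtain ⟨h, hh, hhC⟩ := Set.not_subset.1 (hm ▸ Nat.find_spec hall)
      calc μ S ≤ μ (C m g) := measure_mono hsub
        _ ≤ (k m : ℝ≥0∞)⁻¹ := hC m g
        _ ≤ (((levelStab n m).index : ℝ≥0∞)⁻¹) ^ (s : ℝ) := by
          rw [ENNReal.inv_rpow]
          exact ENNReal.inv_le_inv.2 (hks m)
        _ ≤ Metric.ediam S ^ (s : ℝ) := by
          refine ENNReal.rpow_le_rpow ?_ s.2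
          exact (inv_index_le_edist hhC).trans (Metric.edist_le_ediam_of_mem hg hh)
  have hdim : (s : ℝ≥0∞) ≤ dimH (Set.univ : Set H) := by
    refine le_dimH_of_hausdorffMeasure_ne_zero fun h0 => ?_
    have := hle Set.univ
    rw [h0, hμ] at this
    simp at this
  rwa [← isometry_subtype_coe.dimH_image, Set.image_univ, Subtype.range_coe] at hdim

theorem topologicallyFG_closure (n : ℕ) : TopologicallyFG (G n).topologicalClosure := by
  classical
  let a : Fin n → (G n).topologicalClosure := fun i =>
    ⟨gen i, (G n).le_topologicalClosure (gen_mem i)⟩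
  refine ⟨Finset.univ.image a, ?_⟩
  have hmap : (Subgroup.closure (Finset.univ.image a : Set (G n).topologicalClosure)).map
      (G n).topologicalClosure.subtype = G n := by
    rw [MonoidHom.map_closure]
    change _ = Subgroup.closure _
    congr 1
    ext g
    simp [a]
  rw [Subtype.dense_iff]
  intro g hg
  have := congrArg (fun K : Subgroup (TreeAut n) => (K : Set (TreeAut n))) hmap
  rw [Subgroup.coe_map] at this
  change g ∈ closure ((G n).topologicalClosure.subtype '' _)
  rw [this]
  exact hg

end HanoiTree

namespace HanoiTree

open Filter Topology Finset
open scoped ENNReal NNReal Nat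

/-! ### Dimension bounds for a given n, and the choice of n. -/

theorem le_geom_sum {n : ℕ} (hn : 1 ≤ n) (m : ℕ) : m ≤ ∑ i ∈ range m, n ^ i := by
  simpa using Finset.card_nsmul_le_sum (range m) (fun i => n ^ i) 1 fun i _ => Nat.one_le_pow _ _ hn

theorem tendsto_inv_natCast_of_le {k : ℕ → ℕ} (hk : ∀ m, m ≤ k m) :
    Tendsto (fun m => (k m : ℝ≥0∞)⁻¹) atTop (𝓝 0) :=
  ENNReal.tendsto_inv_nat_nhds_zero.comp (tendsto_atTop_mono hk tendsto_id)

/-- Bounds for the Hausdorff dimension of the closure of `G n`. -/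
theorem dimH_closure_bounds {n : ℕ} (hn : 5 ≤ n) {s : ℝ≥0}
    (hs : (n ! : ℝ) ^ (s : ℝ) ≤ (n ! : ℝ) / 2) :
    (s : ℝ≥0∞) ≤ dimH ((G n).topologicalClosure : Set (TreeAut n)) ∧
      dimH ((G n).topologicalClosure : Set (TreeAut n)) ≤ 1 := by
  obtain ⟨K, hKG, hA, hK⟩ := exists_branching_subgroup hn
  set c := Nat.card (alternatingGroup (Fin n)) with hc
  have : Nontrivial (Fin n) := Fin.nontrivial_iff_two_le.2 (by omega)
  have hc2 : 2 * c = n ! := by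
    rw [hc, two_mul_nat_card_alternatingGroup, Nat.card_perm, Nat.card_fin]
  have hc1 : 2 ≤ c := by
    have := Nat.factorial_le hn
    have h5 : 5 ! = 120 := rfl
    omega
  have hck : ∀ m, m ≤ c ^ ∑ i ∈ range m, n ^ i := fun m =>
    (Nat.lt_pow_self hc1).le.trans (Nat.pow_le_pow_right (by omega) (le_geom_sum (by omega) m))
  have hfam := exists_family_of_branching hA hK
  have hI : ∀ m, m ≤ (levelStab n m).index := fun m => by
    obtain ⟨ι, _, f, -, hinj, hcard⟩ := hfam m
    refine (hck m).trans ?_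
    rw [← hcard]
    exact Nat.card_le_card_of_injective (fun i => (f i : TreeAut n ⧸ levelStab n m))
      fun i j hij => hinj i j (QuotientGroup.eq.1 hij)
  have hI0 := tendsto_inv_natCast_of_le hI
  have := compactSpace_treeAut hI0
  refine ⟨le_dimH_of_family (Subgroup.isClosed_topologicalClosure _)
    (tendsto_inv_natCast_of_le hck) (fun m => ?_) fun m => ?_, dimH_le_one hI0 _⟩
  · have hs' : (n ! : ℝ≥0∞) ^ (s : ℝ) ≤ c := by
      have hcr : (n ! : ℝ) / 2 = c := by
        rw [← hc2]
        push_cast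
        ring
      rw [hcr] at hs
      have := ENNReal.ofReal_le_ofReal hs
      rwa [← ENNReal.ofReal_rpow_of_nonneg (Nat.cast_nonneg _) s.coe_nonneg, ENNReal.ofReal_natCast,
        ENNReal.ofReal_natCast] at this
    calc ((levelStab n m).index : ℝ≥0∞) ^ (s : ℝ)
        ≤ ((n ! : ℝ≥0∞) ^ ∑ i ∈ range m, n ^ i) ^ (s : ℝ) := by
          refine ENNReal.rpow_le_rpow ?_ s.2
          exact_mod_cast index_levelStab_le n m
      _ = ((n ! : ℝ≥0∞) ^ (s : ℝ)) ^ ∑ i ∈ range m, n ^ i := by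
          rw [← ENNReal.rpow_natCast, ← ENNReal.rpow_natCast, ← ENNReal.rpow_mul,
            ← ENNReal.rpow_mul, mul_comm]
      _ ≤ (c : ℝ≥0∞) ^ ∑ i ∈ range m, n ^ i := by gcongr
      _ = _ := by push_cast; rfl
  · obtain ⟨ι, hι, f, hf, hinj, hcard⟩ := hfam m
    exact ⟨ι, hι, f, fun i => (G n).le_topologicalClosure (hKG (hf i)), hinj, hcard⟩

/-- The claim amounts to (n!)^(1-s) ≥ 2, and the left side tends to infinity. -/
theorem exists_factorial_rpow_le {s : ℝ} (hs : s < 1) :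
    ∃ n : ℕ, 5 ≤ n ∧ (n ! : ℝ) ^ s ≤ (n ! : ℝ) / 2 := by
  have h : Tendsto (fun n : ℕ => ((n ! : ℕ) : ℝ) ^ (1 - s)) atTop atTop :=
    (tendsto_rpow_atTop (sub_pos.2 hs)).comp (tendsto_natCast_atTop_atTop.comp
      (tendsto_atTop_mono Nat.self_le_factorial tendsto_id))
  obtain ⟨n, hn, h5⟩ := ((h.eventually_ge_atTop 2).and (eventually_ge_atTop 5)).exists
  refine ⟨n, h5, ?_⟩
  have hpos : (0 : ℝ) < n ! := by exact_mod_cast n.factorial_pos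
  have hmul : (n ! : ℝ) ^ s * (n ! : ℝ) ^ (1 - s) = n ! := by
    rw [← Real.rpow_add hpos, add_sub_cancel, Real.rpow_one]
  have := mul_le_mul_of_nonneg_left hn (Real.rpow_nonneg hpos.le s)
  rw [hmul] at this
  linarith

end HanoiTree

theorem mainTheorem10 (ε : ℝ) (hε : 0 < ε) :
    ∃ n : ℕ, 3 ≤ n ∧
      HanoiTree.TopologicallyFG (HanoiTree.G n).topologicalClosure ∧
      1 - ε < (dimH ((HanoiTree.G n).topologicalClosure : Set (HanoiTree.TreeAut n))).toReal ∧
      dimH ((HanoiTree.G n).topologicalClosure : Set (HanoiTree.TreeAut n)) ≤ 1 := by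
  obtain ⟨s, hs0, hs1, hsε⟩ : ∃ s : ℝ, 0 ≤ s ∧ s < 1 ∧ 1 - ε < s := by
    -- The maximum with 0 keeps the exponent nonnegative when ε is large.
    refine ⟨max 0 (1 - ε / 2), le_max_left _ _, max_lt one_pos (by linarith),
      lt_max_of_lt_right (by linarith)⟩
  obtain ⟨n, hn, h⟩ := HanoiTree.exists_factorial_rpow_le hs1
  lift s to NNReal using hs0
  obtain ⟨h1, h2⟩ := HanoiTree.dimH_closure_bounds hn h
  refine ⟨n, by omega, HanoiTree.topologicallyFG_closure n, hsε.trans_le ?_, h2⟩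
  exact ENNReal.toReal_mono (ne_top_of_le_ne_top ENNReal.one_ne_top h2) h1
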